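/- Let $\ell_2$ be the Hilbert space of square-summable sequences $u=(u_i)_{i\in\mathbb Z}$ of real numbers, and let $C(\mathbb R,\ell_2)$ be the space of continuous functions $\mathbb R\to\ell_2$ with the compact-open topology, on which $\mathbb R$ acts by the shifts $\sigma(h,g)=g^h$, $g^h(t)=g(t+h)$. For $f\in C(\mathbb R,\ell_2)$ let $H(f)$ be the closure of $\{f^h : h\in\mathbb R\}$ in $C(\mathbb R,\ell_2)$, with the shift dynamical system $(H(f),\mathbb R,\sigma)$. Let $\lambda>0$, $\nu\ge 0$ and $\alpha\ge 0$ be real numbers, and assume: * (C1) $f\in C(\mathbb R,\ell_2)$ is translation-compact, i.e. $\{f^h : h\in\mathbb R\}$ is precompact in $C(\mathbb R,\ell_2)$; * (C2) $F:\mathbb R\to\mathbb R$ is Lipschitz continuous on bounded sets and $F(0)=0$; * (C3) $sF(s)\le-\alpha s^2$ for all $s\in\mathbb R$. Let $(\Lambda u)_i=u_{i-1}-2u_i+u_{i+1}$ and $\widetilde F(u)_i=F(u_i)$ for $u\in\ell_2$, $i\in\mathbb Z$; these are maps $\ell_2\to\ell_2$. Then for all $v\in\ell_2$ and $g\in H(f)$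 the equation $$u'=\nu\Lambda u-\lambda u+\widetilde F(u)+g(t)$$ has a solution $t\mapsto\varphi(t,v,g)$ in $\ell_2$ on $[0,\infty)$ with $\varphi(0,v,g)=v$, and every solution with value $v$ at $t=0$ on an interval $[0,T)$ agrees with it there. The map $\varphi:\mathbb R_+\times\ell_2\times H(f)\to\ell_2$ is a cocycle over $(H(f),\mathbb R,\sigma)$: it is continuous, $\varphi(0,v,g)=v$, and $\varphi(t+\tau,v,g)=\varphi(t,\varphi(\tau,v,g),g^\tau)$ for all $t,\tau\ge0$. This cocycle has a compact global attractor $\{I_g : g\in H(f)\}$, i.e. a family of non-empty compact sets $I_g\subset\ell_2$ such that 1. $\mathcal I=\bigcup_{g\in H(f)}I_g$ is precompact; 2. $\varphi(t,I_g,g)=I_{g^t}$ for all $t\ge0$ and $g\in H(f)$; 3. for every compact $M\subset\ell_2$, $$\lim_{t\to+\infty}\ \sup_{g\in H(f)}\ \sup_{u\in M}\ \inf_{w\in\mathcal I}\|\varphi(t,u,g)-w\|=0 .$$ -/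

import Mathlib

open scoped NNReal ENNReal Topology

noncomputable section

/-! ### The shift (Bebutov) dynamical system and the hull of a function -/

/-- Bebutov's dynamical system on `C(ℝ, E)` with the compact-open topology:
`σ(h, f)(t) = f(t + h)`. -/
def bebutovFlow (E : Type*) [TopologicalSpace E] : Flow ℝ C(ℝ, E) where
  toFun h f := ⟨fun t => f (t + h), by fun_prop⟩
  cont' := by
    refine ContinuousMap.continuous_of_continuous_uncurry _ ?_
    change Continuous fun p : (ℝ × C(ℝ, E)) × ℝ => p.1.2 (p.2 + p.1.1)
    fun_prop
  map_add' a b f := by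
    ext t
    change f (t + (a + b)) = f (t + a + b)
    rw [add_assoc]
  map_zero' f := by
    ext t
    change f (t + 0) = f t
    rw [add_zero]

/-- The set of all translates `{f^h | h ∈ ℝ}`. -/
def translates {E : Type*} [TopologicalSpace E] (f : C(ℝ, E)) : Set C(ℝ, E) :=
  Set.range fun h : ℝ => bebutovFlow E h f

/-- `f` is translation-compact: its set of translates is precompact in `C(ℝ, E)`. -/
def TranslationCompact {E : Type*} [TopologicalSpace E] (f : C(ℝ, E)) : Prop :=
  IsCompact (closure (translates f))

/-- The hull `H(f)`: the closure of the set of translates. -/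
def hull {E : Type*} [TopologicalSpace E] (f : C(ℝ, E)) : Set C(ℝ, E) :=
  closure (translates f)

theorem mapsTo_bebutovFlow_hull {E : Type*} [TopologicalSpace E] (f : C(ℝ, E)) (h : ℝ) :
    Set.MapsTo (bebutovFlow E h) (hull f) (hull f) := by
  refine Set.MapsTo.closure ?_ ((bebutovFlow E).continuous_toFun h)
  rintro _ ⟨k, rfl⟩
  exact ⟨h + k, (bebutovFlow E).map_add h k f⟩

/-- The shift dynamical system `(H(f), ℝ, σ)`. -/
def hullFlow {E : Type*} [TopologicalSpace E] (f : C(ℝ, E)) : Flow ℝ (hull f) where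
  toFun h := (mapsTo_bebutovFlow_hull f h).restrict
  cont' := by
    refine Continuous.subtype_mk ?_ _
    exact (bebutovFlow E).cont'.comp (continuous_fst.prodMk (continuous_subtype_val.comp continuous_snd))
  map_add' a b g := Subtype.ext ((bebutovFlow E).map_add a b g)
  map_zero' g := Subtype.ext ((bebutovFlow E).map_zero_apply g)

/-! ### Cocycles and their compact global attractors -/

/-- `φ` is a cocycle over the dynamical system `(Y, ℝ, σ)` with fibre `E`. -/
structure IsCocycle {E Y : Type*} [TopologicalSpace E] [TopologicalSpace Y]
    (σ : Flow ℝ Y) (φ : ℝ≥0 → E → Y → E) : Prop where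
  continuous : Continuous fun p : ℝ≥0 × E × Y => φ p.1 p.2.1 p.2.2
  zero : ∀ u y, φ 0 u y = u
  add : ∀ t τ u y, φ (t + τ) u y = φ t (φ τ u y) (σ (τ : ℝ) y)

/-- The semi-distance `β(A, B) = sup_{a ∈ A} inf_{b ∈ B} ρ(a, b)`, with values in `[0, ∞]`
(so that it is `∞` when `A` is non-empty and `B` is empty). -/
def semiDist {E : Type*} [PseudoEMetricSpace E] (A B : Set E) : ℝ≥0∞ :=
  ⨆ a ∈ A, Metric.infEDist a B

/-- The family `I` of non-empty compact sets is a compact global attractor of the cocycle `φ`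
over `(Y, ℝ, σ)`. -/
structure IsCompactGlobalAttractor {E Y : Type*} [PseudoEMetricSpace E] [TopologicalSpace Y]
    (σ : Flow ℝ Y) (φ : ℝ≥0 → E → Y → E) (I : Y → Set E) : Prop where
  nonempty : ∀ y, (I y).Nonempty
  isCompact : ∀ y, IsCompact (I y)
  precompact : IsCompact (closure (⋃ y, I y))
  invariant : ∀ (t : ℝ≥0) y, (fun u => φ t u y) '' I y = I (σ (t : ℝ) y)
  attracts : ∀ M : Set E, IsCompact M →
    Filter.Tendsto (fun t : ℝ≥0 => ⨆ y, semiDist ((fun u => φ t u y) '' M) (⋃ y, I y))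
      Filter.atTop (𝓝 0)

/-! ### The lattice equation in `ℓ₂` -/

/-- The Hilbert space of square-summable two-sided real sequences. -/
abbrev EllTwo : Type := lp (fun _ : ℤ => ℝ) 2

/-- Lipschitz continuity on bounded sets. -/
def LipschitzOnBounded (F : ℝ → ℝ) : Prop :=
  ∀ B : Set ℝ, Bornology.IsBounded B → ∃ L : ℝ≥0, LipschitzOnWith L F B

theorem memEllTwo_iff (x : ℤ → ℝ) :
    Memℓp x 2 ↔ Summable fun i => x i ^ 2 := by
  rw [memℓp_gen_iff (by norm_num)]
  simp

/-- Translation of the index of a sequence in `ℓ₂`: `(shift n u)_i = u_{i + n}`. -/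
def EllTwo.shift (n : ℤ) (u : EllTwo) : EllTwo :=
  ⟨fun i => u (i + n), by
    refine (memEllTwo_iff _).2 ?_
    exact ((memEllTwo_iff _).1 (lp.memℓp u)).comp_injective (add_left_injective n)⟩

/-- The discrete Laplace operator. -/
def discreteLaplacian (u : EllTwo) : EllTwo :=
  EllTwo.shift (-1) u - (2 : ℝ) • u + EllTwo.shift 1 u

theorem discreteLaplacian_apply (u : EllTwo) (i : ℤ) :
    discreteLaplacian u i = u (i - 1) - 2 * u i + u (i + 1) := rfl

/-- The Nemytskii operator `F̃(u)_i = F(u_i)` on `ℓ₂`. -/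
def nemytskii (F : ℝ → ℝ) (hF : LipschitzOnBounded F) (hF0 : F 0 = 0) (u : EllTwo) : EllTwo :=
  ⟨fun i => F (u i), by
    obtain ⟨L, hL⟩ := hF (Metric.closedBall 0 ‖u‖) Metric.isBounded_closedBall
    refine (memEllTwo_iff _).2 ?_
    refine Summable.of_nonneg_of_le (fun i => sq_nonneg _) (fun i => ?_)
      (((memEllTwo_iff _).1 (lp.memℓp u)).mul_left ((L : ℝ) ^ 2))
    have h1 : u i ∈ Metric.closedBall (0 : ℝ) ‖u‖ := by
      rw [mem_closedBall_zero_iff]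
      exact lp.norm_apply_le_norm (by norm_num) u i
    have h2 : (0 : ℝ) ∈ Metric.closedBall (0 : ℝ) ‖u‖ := by simp
    have h3 := hL.dist_le_mul _ h1 _ h2
    rw [hF0, dist_zero_right, dist_zero_right, Real.norm_eq_abs, Real.norm_eq_abs] at h3
    rw [← mul_pow, ← sq_abs (F (u i))]
    calc |F (u i)| ^ 2 ≤ ((L : ℝ) * |u i|) ^ 2 := by gcongr
      _ = ((L : ℝ) * u i) ^ 2 := by rw [mul_pow, mul_pow, sq_abs]⟩

theorem nemytskii_apply (F : ℝ → ℝ) (hF : LipschitzOnBounded F) (hF0 : F 0 = 0) (u : EllTwo)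
    (i : ℤ) : nemytskii F hF hF0 u i = F (u i) := rfl

/-- `u` solves `u' = ν Λ u - lam u + F̃(u) + g(t)` in `ℓ₂` on the interval `J` (with one-sided
derivatives at the end points that belong to `J`). -/
def IsLatticeSolutionOn (ν lam : ℝ) (F : ℝ → ℝ) (hF : LipschitzOnBounded F) (hF0 : F 0 = 0)
    (g : C(ℝ, EllTwo)) (J : Set ℝ) (u : ℝ → EllTwo) : Prop :=
  ∀ t ∈ J, HasDerivWithinAt u
    (ν • discreteLaplacian (u t) - lam • u t + nemytskii F hF hF0 (u t) + g t) J t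

/-- The map `φ` on `ℝ₊ × ℓ₂ × H(f)` is generated by the family of equations
`u' = ν Λ u - lam u + F̃(u) + g(t)`, `g ∈ H(f)`: for all `v` and `g`, `t ↦ φ(t, v, g)` is a
solution on `[0, ∞)` with value `v` at `t = 0`, and any solution on some `[0, T)` with value `v`
at `t = 0` agrees with it. -/
structure IsGeneratedByLattice (ν lam : ℝ) (F : ℝ → ℝ) (hF : LipschitzOnBounded F)
    (hF0 : F 0 = 0) (f : C(ℝ, EllTwo)) (φ : ℝ≥0 → EllTwo → hull f → EllTwo) : Prop where
  initial : ∀ v g, φ 0 v g = v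
  solution : ∀ v (g : hull f), IsLatticeSolutionOn ν lam F hF hF0 (g : C(ℝ, EllTwo)) (Set.Ici 0)
    fun t => φ t.toNNReal v g
  unique : ∀ v (g : hull f) (T : ℝ) (u : ℝ → EllTwo), u 0 = v →
    IsLatticeSolutionOn ν lam F hF hF0 (g : C(ℝ, EllTwo)) (Set.Ico 0 T) u →
    ∀ t ∈ Set.Ico 0 T, u t = φ t.toNNReal v g

end

/-! The damping `-lam • u` controls not only the norm but also the tails of solutions. For a weight
`ρ` with values in `[0, 1]` and `ν Δρ ≤ (lam / 2) ρ`, put `E(u) = ∑ ρ i * u i ^ 2`. Summation by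
parts moves the Laplacian onto `ρ`, the sign condition discards the nonlinearity, Young's inequality
absorbs the forcing, and Gronwall gives `E(u t) ≤ e⁻ᵏ E(u 0) + (1 - e⁻ᵏ) B` with `k = lam * t` and
`B = (2 / lam²) sup E(g)` (`weightedSq_solution_le`).

The weight `1` bounds the norm. Hence truncating `F` far out does not change a given solution, and
the global Lipschitz theory yields existence, uniqueness and continuous dependence.

The weights `tailWeight c k` equal `1` far out and tend to `0` pointwise as `k → ∞`. The values of
the hull form a compact set, so by Dini their tails `a k` are uniformly small. The set `K` of all
`u` with tails at most `(2 / lam²) a k` is compact, positively invariant, and contains every limit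
at infinite time of trajectories that start in a compact set.

Such a `K` gives the attractor abstractly: over `y`, intersect the images of `K` under evolution
from the base points at times `-s` (`isCompactGlobalAttractor_pullbackLimit`). -/

/-! ### Attractors of compact dissipative cocycles -/

/-- The pullback limit set over `y` of the set `K`. -/
def pullbackLimit {E Y : Type*} [TopologicalSpace Y] (σ : Flow ℝ Y) (φ : ℝ≥0 → E → Y → E)
    (K : Set E) (y : Y) : Set E :=
  ⋂ s : ℝ≥0, (fun u => φ s u (σ (-(s : ℝ)) y)) '' K

section PullbackLimit

variable {E Y : Type*} [TopologicalSpace E] [TopologicalSpace Y] {σ : Flow ℝ Y}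
  {φ : ℝ≥0 → E → Y → E} {K : Set E}

theorem IsCocycle.continuous_left (hφ : IsCocycle σ φ) (t : ℝ≥0) (y : Y) :
    Continuous fun u => φ t u y :=
  hφ.continuous.comp (f := fun u => (t, u, y)) (by fun_prop)

theorem IsCocycle.apply_add_neg (hφ : IsCocycle σ φ) (t s : ℝ≥0) (u : E) (y : Y) :
    φ (t + s) u (σ (-((t + s : ℝ≥0) : ℝ)) y)
      = φ t (φ s u (σ (-((t + s : ℝ≥0) : ℝ)) y)) (σ (-(t : ℝ)) y) := by
  rw [hφ.add, ← σ.map_add]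
  congr 2
  push_cast
  ring

/-- A trajectory started earlier in `K` is still in `K` at the later starting time. Monotonicity
turns the pullback limit into a nested intersection of compact sets. -/
theorem IsCocycle.antitone_image (hφ : IsCocycle σ φ)
    (hK : ∀ t, ∀ u ∈ K, ∀ y, φ t u y ∈ K) (y : Y) :
    Antitone fun s : ℝ≥0 => (fun u => φ s u (σ (-(s : ℝ)) y)) '' K := by
  intro s t hst
  rintro _ ⟨u, hu, rfl⟩
  obtain ⟨r, rfl⟩ := exists_add_of_le hst
  exact ⟨φ r u (σ (-((s + r : ℝ≥0) : ℝ)) y), hK _ _ hu _, (hφ.apply_add_neg s r u y).symm⟩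

theorem pullbackLimit_subset (hφ : IsCocycle σ φ) (y : Y) : pullbackLimit σ φ K y ⊆ K := by
  intro z hz
  obtain ⟨u, hu, rfl⟩ := Set.mem_iInter.1 hz 0
  simpa [hφ.zero] using hu

theorem isCompact_image_cocycle (hφ : IsCocycle σ φ) (hKc : IsCompact K) (s : ℝ≥0) (y : Y) :
    IsCompact ((fun u => φ s u y) '' K) :=
  hKc.image (hφ.continuous_left s y)

theorem isCompact_pullbackLimit [T2Space E] (hφ : IsCocycle σ φ) (hKc : IsCompact K) (y : Y) :
    IsCompact (pullbackLimit σ φ K y) :=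
  hKc.of_isClosed_subset
    (isClosed_iInter fun _ => (isCompact_image_cocycle hφ hKc _ _).isClosed)
    (pullbackLimit_subset hφ y)

theorem pullbackLimit_nonempty [T2Space E] (hφ : IsCocycle σ φ) (hKc : IsCompact K)
    (hKne : K.Nonempty) (hK : ∀ t, ∀ u ∈ K, ∀ y, φ t u y ∈ K) (y : Y) :
    (pullbackLimit σ φ K y).Nonempty :=
  IsCompact.nonempty_iInter_of_directed_nonempty_isCompact_isClosed _
    (hφ.antitone_image hK y).directed_ge (fun _ => hKne.image _)
    (fun _ => isCompact_image_cocycle hφ hKc _ _)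
    (fun _ => (isCompact_image_cocycle hφ hKc _ _).isClosed)

theorem image_pullbackLimit [T2Space E] (hφ : IsCocycle σ φ) (hKc : IsCompact K)
    (hK : ∀ t, ∀ u ∈ K, ∀ y, φ t u y ∈ K) (t : ℝ≥0) (y : Y) :
    (fun u => φ t u y) '' pullbackLimit σ φ K y = pullbackLimit σ φ K (σ (t : ℝ) y) := by
  apply Set.Subset.antisymm
  · rintro _ ⟨u, hu, rfl⟩
    refine Set.mem_iInter.2 fun s => ?_
    rcases le_total t s with hts | hst
    · obtain ⟨r, rfl⟩ := exists_add_of_le hts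
      obtain ⟨w, hw, rfl⟩ := Set.mem_iInter.1 hu r
      refine ⟨w, hw, ?_⟩
      have e : σ (-((t + r : ℝ≥0) : ℝ)) (σ (t : ℝ) y) = σ (-(r : ℝ)) y := by
        rw [← σ.map_add]; congr 1; push_cast; ring
      have e2 : σ (r : ℝ) (σ (-(r : ℝ)) y) = y := by
        rw [← σ.map_add]; simp
      simp only [e, hφ.add, e2]
    · obtain ⟨r, rfl⟩ := exists_add_of_le hst
      refine ⟨φ r u y, hK _ _ (pullbackLimit_subset hφ y hu) _, ?_⟩
      have e : σ (-(s : ℝ)) (σ ((s + r : ℝ≥0) : ℝ) y) = σ (r : ℝ) y := by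
        rw [← σ.map_add]; congr 1; push_cast; ring
      simp only [e, hφ.add]
  -- A preimage of `z` must lie in all the pullback images at once. The preimages within each one
  -- form a decreasing family of non-empty compact sets, so Cantor's intersection theorem supplies
  -- it.
  · intro z hz
    let B : ℝ≥0 → Set E := fun s =>
      (fun u => φ s u (σ (-(s : ℝ)) y)) '' K ∩ {u | φ t u y = z}
    have hBcl : IsClosed {u | φ t u y = z} :=
      isClosed_singleton.preimage (hφ.continuous_left t y)
    have hanti : Antitone B := fun s r hsr =>
      Set.inter_subset_inter_left _ (hφ.antitone_image hK y hsr)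
    have hne : ∀ s, (B s).Nonempty := by
      intro s
      obtain ⟨w, hw, rfl⟩ := Set.mem_iInter.1 hz (t + s)
      refine ⟨φ s w (σ (-(s : ℝ)) y), ⟨w, hw, rfl⟩, ?_⟩
      have e : σ (-((t + s : ℝ≥0) : ℝ)) (σ (t : ℝ) y) = σ (-(s : ℝ)) y := by
        rw [← σ.map_add]; congr 1; push_cast; ring
      have e2 : σ (s : ℝ) (σ (-(s : ℝ)) y) = y := by
        rw [← σ.map_add]; simp
      simp only [Set.mem_ofPred_eq, e, hφ.add, e2]
    have hc : ∀ s, IsCompact (B s) := fun s =>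
      (isCompact_image_cocycle hφ hKc _ _).inter_right hBcl
    obtain ⟨w, hw⟩ := IsCompact.nonempty_iInter_of_directed_nonempty_isCompact_isClosed B
      hanti.directed_ge hne hc (fun s => (hc s).isClosed)
    have hw' := Set.mem_iInter.1 hw
    exact ⟨w, Set.mem_iInter.2 fun s => (hw' s).1, (hw' 0).2⟩

end PullbackLimit

/-- A cocycle over a compact base has a compact global attractor as soon as there is a positively
invariant compact set which contains all limits of trajectories starting in a compact set. -/
theorem isCompactGlobalAttractor_pullbackLimit {E Y : Type*} [EMetricSpace E]
    [TopologicalSpace Y] [CompactSpace Y] {σ : Flow ℝ Y}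
    {φ : ℝ≥0 → E → Y → E} {K : Set E} (hφ : IsCocycle σ φ) (hKc : IsCompact K)
    (hKne : K.Nonempty) (hK : ∀ t, ∀ u ∈ K, ∀ y, φ t u y ∈ K)
    (hlim : ∀ M : Set E, IsCompact M → ∀ U : Ultrafilter (ℝ≥0 × E × Y),
      Filter.Tendsto (fun p : ℝ≥0 × E × Y => p.1) U Filter.atTop →
      (∀ᶠ p in (U : Filter (ℝ≥0 × E × Y)), p.2.1 ∈ M) →
      ∃ w ∈ K, Filter.Tendsto (fun p : ℝ≥0 × E × Y => φ p.1 p.2.1 p.2.2) U (𝓝 w)) :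
    IsCompactGlobalAttractor σ φ (pullbackLimit σ φ K) where
  nonempty := pullbackLimit_nonempty hφ hKc hKne hK
  isCompact := isCompact_pullbackLimit hφ hKc
  precompact := hKc.of_isClosed_subset isClosed_closure
    (closure_minimal (Set.iUnion_subset fun y => pullbackLimit_subset hφ y) hKc.isClosed)
  invariant := image_pullbackLimit hφ hKc hK
  attracts := by
    intro M hM
    set A : Set E := ⋃ y, pullbackLimit σ φ K y with hA
    -- Along this filter time tends to infinity, the initial value stays in `M` and the base point
    -- is free; convergence along it is therefore uniform in the last two.
    set L : Filter (ℝ≥0 × E × Y) :=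
      Filter.comap (fun p : ℝ≥0 × E × Y => p.1) Filter.atTop ⊓
        Filter.principal {p | p.2.1 ∈ M} with hL
    have key : Filter.Tendsto
        (fun p : ℝ≥0 × E × Y => Metric.infEDist (φ p.1 p.2.1 p.2.2) A) L (𝓝 0) := by
      rw [Filter.tendsto_iff_ultrafilter]
      intro U hU
      have hUt : Filter.Tendsto (fun p : ℝ≥0 × E × Y => p.1) U Filter.atTop :=
        Filter.tendsto_iff_comap.2 (hU.trans inf_le_left)
      have hUM : ∀ᶠ p in (U : Filter (ℝ≥0 × E × Y)), p.2.1 ∈ M :=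
        Filter.le_principal_iff.1 (hU.trans inf_le_right)
      obtain ⟨z, -, hz⟩ := hlim M hM U hUt hUM
      obtain ⟨y, hy⟩ : ∃ y, Filter.Tendsto
          (fun p : ℝ≥0 × E × Y => σ (p.1 : ℝ) p.2.2) U (𝓝 y) := by
        obtain ⟨y, -, hy⟩ := isCompact_univ.ultrafilter_le_nhds
          (U.map fun p : ℝ≥0 × E × Y => σ (p.1 : ℝ) p.2.2) (by simp)
        exact ⟨y, hy⟩
      -- Split off the last `s` units of time: the states at time `t - s` converge to some `w ∈ K`,
      -- and continuity of `φ s` gives `z = φ s w (σ (-s) y)`. The truncated subtraction in `S` is a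
      -- true one eventually.
      have hzA : z ∈ A := by
        refine Set.mem_iUnion.2 ⟨y, Set.mem_iInter.2 fun s => ?_⟩
        let S : ℝ≥0 × E × Y → ℝ≥0 × E × Y := fun p => (p.1 - s, p.2)
        obtain ⟨w, hwK, hw⟩ := hlim M hM (U.map S)
          (by
            change Filter.Tendsto (fun p : ℝ≥0 × E × Y => p.1) (Filter.map S U) Filter.atTop
            rw [Filter.tendsto_map'_iff]
            refine Filter.tendsto_atTop.2 fun b => ?_
            filter_upwards [Filter.tendsto_atTop.1 hUt (b + s)] with p hp
            exact le_tsub_of_add_le_right hp)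
          (by
            change ∀ᶠ p in Filter.map S (U : Filter (ℝ≥0 × E × Y)), p.2.1 ∈ M
            exact Filter.eventually_map.2 hUM)
        refine ⟨w, hwK, ?_⟩
        have hw1 : Filter.Tendsto (fun p : ℝ≥0 × E × Y => φ (p.1 - s) p.2.1 p.2.2) U (𝓝 w) :=
          Filter.tendsto_map'_iff.1 hw
        have hy1 : Filter.Tendsto
            (fun p : ℝ≥0 × E × Y => σ (-(s : ℝ)) (σ (p.1 : ℝ) p.2.2)) U
            (𝓝 (σ (-(s : ℝ)) y)) :=
          ((σ.continuous_toFun (-(s : ℝ))).tendsto y).comp hy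
        have hc : Filter.Tendsto (fun p : ℝ≥0 × E × Y =>
            φ s (φ (p.1 - s) p.2.1 p.2.2) (σ (-(s : ℝ)) (σ (p.1 : ℝ) p.2.2))) U
            (𝓝 (φ s w (σ (-(s : ℝ)) y))) :=
          (hφ.continuous.tendsto (s, w, σ (-(s : ℝ)) y)).comp
            (tendsto_const_nhds.prodMk_nhds (hw1.prodMk_nhds hy1))
        refine tendsto_nhds_unique (hc.congr' ?_) hz
        filter_upwards [Filter.tendsto_atTop.1 hUt s] with p hp
        have e : σ (-(s : ℝ)) (σ (p.1 : ℝ) p.2.2) = σ ((p.1 - s : ℝ≥0) : ℝ) p.2.2 := by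
          rw [← σ.map_add, NNReal.coe_sub hp]; congr 1; ring
        rw [e, ← hφ.add, add_tsub_cancel_of_le hp]
      have hcont : Filter.Tendsto
          (fun p : ℝ≥0 × E × Y => Metric.infEDist (φ p.1 p.2.1 p.2.2) A) U
          (𝓝 (Metric.infEDist z A)) :=
        (Metric.continuous_infEDist.tendsto z).comp hz
      rwa [Metric.infEDist_zero_of_mem hzA] at hcont
    rw [ENNReal.tendsto_nhds_zero] at key ⊢
    intro ε hε
    have h1 := key ε hε
    rw [hL, Filter.eventually_inf_principal, Filter.eventually_comap] at h1
    filter_upwards [h1] with t ht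
    refine iSup_le fun y => iSup₂_le ?_
    rintro _ ⟨u, hu, rfl⟩
    exact ht (t, u, y) rfl hu

/-! ### Global solutions of Lipschitz differential equations -/

section GlobalODE

variable {E : Type*} [NormedAddCommGroup E] [NormedSpace ℝ E]

theorem integral_exp_mul_le {μ : ℝ} (hμ : 0 < μ) (t : ℝ) :
    ∫ s in (0 : ℝ)..t, Real.exp (μ * s) ≤ Real.exp (μ * t) / μ := by
  have h : ∫ s in (0 : ℝ)..t, Real.exp (μ * s) = Real.exp (μ * t) / μ - 1 / μ := by
    rw [intervalIntegral.integral_comp_mul_left _ hμ.ne', integral_exp]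
    simp [smul_eq_mul]
    ring
  rw [h]
  have : 0 < 1 / μ := by positivity
  linarith

theorem norm_exp_smul_integral_le {μ : ℝ} (hμ : 0 < μ) {t : ℝ} (ht : 0 ≤ t) {h : ℝ → E} {B : ℝ}
    (hB : 0 ≤ B) (hh : ∀ s ∈ Set.Ioc 0 t, ‖h s‖ ≤ B * Real.exp (μ * s)) :
    ‖Real.exp (-(μ * t)) • ∫ s in (0 : ℝ)..t, h s‖ ≤ B / μ := by
  have h1 : ‖∫ s in (0 : ℝ)..t, h s‖ ≤ ∫ s in (0 : ℝ)..t, B * Real.exp (μ * s) :=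
    intervalIntegral.norm_integral_le_of_norm_le ht (Filter.Eventually.of_forall hh)
      (Continuous.intervalIntegrable (by fun_prop) _ _)
  rw [intervalIntegral.integral_const_mul] at h1
  have h2 := mul_le_mul_of_nonneg_left (integral_exp_mul_le hμ t) hB
  rw [norm_smul, Real.norm_eq_abs, Real.abs_exp]
  calc Real.exp (-(μ * t)) * ‖∫ s in (0 : ℝ)..t, h s‖
      ≤ Real.exp (-(μ * t)) * (B * (Real.exp (μ * t) / μ)) := by gcongr; exact h1.trans h2
    _ = B / μ * (Real.exp (-(μ * t)) * Real.exp (μ * t)) := by ring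
    _ = B / μ := by rw [← Real.exp_add]; simp

/-- An ordinary differential equation whose right-hand side is continuous, globally Lipschitz in
the state, and bounded along the zero state, has a solution on `[0, ∞)`. -/
theorem exists_solution_Ici_of_lipschitzWith [CompleteSpace E] {G : ℝ → E → E} {K : ℝ≥0} {C : ℝ}
    (hG : Continuous fun p : ℝ × E => G p.1 p.2) (hK : ∀ t, LipschitzWith K (G t))
    (hC : ∀ t, ‖G t 0‖ ≤ C) (v : E) :
    ∃ u : ℝ → E, u 0 = v ∧
      ∀ t ∈ Set.Ici (0 : ℝ), HasDerivWithinAt u (G t (u t)) (Set.Ici 0) t := by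
  have hC0 : 0 ≤ C := (norm_nonneg _).trans (hC 0)
  -- In the norm weighted by `exp (-μ t)` the Picard operator has Lipschitz constant `K / μ < 1`, so
  -- one contraction covers all of `[0, ∞)`.
  set μ : ℝ := K + 1 with hμdef
  have hμ : 0 < μ := by positivity
  let u (w : BoundedContinuousFunction ℝ E) (s : ℝ) : E := Real.exp (μ * s) • w s
  have hu (w) : Continuous (u w) := by
    have := w.continuous
    fun_prop
  have hGu (w) : Continuous fun s => G s (u w s) :=
    hG.comp (continuous_id.prodMk (hu w))
  have hint (w) : Continuous fun t : ℝ => ∫ s in (0 : ℝ)..t, G s (u w s) :=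
    intervalIntegral.continuous_primitive (fun a b => (hGu w).intervalIntegrable a b) 0
  -- The Picard operator for the rescaled unknown `w = exp (-μ t) u`; `max t 0` extends it to
  -- negative times as a constant, to stay among bounded functions on `ℝ`.
  let T (w : BoundedContinuousFunction ℝ E) (t : ℝ) : E :=
    Real.exp (-(μ * max t 0)) • (v + ∫ s in (0 : ℝ)..(max t 0), G s (u w s))
  have hTc (w) : Continuous (T w) := by
    have h1 : Continuous fun t : ℝ => ∫ s in (0 : ℝ)..(max t 0), G s (u w s) :=
      (hint w).comp (continuous_id.max continuous_const)
    fun_prop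
  have hTb (w) (t : ℝ) : ‖T w t‖ ≤ ‖v‖ + (C + K * ‖w‖) / μ := by
    change ‖Real.exp (-(μ * max t 0)) • (v + ∫ s in (0 : ℝ)..(max t 0), G s (u w s))‖ ≤ _
    rw [smul_add]
    refine (norm_add_le _ _).trans (add_le_add ?_ ?_)
    · rw [norm_smul, Real.norm_eq_abs, Real.abs_exp]
      refine mul_le_of_le_one_left (norm_nonneg _) (Real.exp_le_one_iff.2 ?_)
      have : 0 ≤ μ * max t 0 := by positivity
      linarith
    · refine norm_exp_smul_integral_le hμ (le_max_right _ _) (by positivity) fun s hs => ?_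
      have h1 : ‖G s (u w s) - G s 0‖ ≤ K * ‖u w s - 0‖ := (hK s).norm_sub_le _ _
      have h2 : ‖u w s‖ ≤ Real.exp (μ * s) * ‖w‖ := by
        change ‖Real.exp (μ * s) • w s‖ ≤ _
        rw [norm_smul, Real.norm_eq_abs, Real.abs_exp]
        gcongr
        exact w.norm_coe_le_norm s
      have h3 : ‖G s (u w s)‖ ≤ ‖G s (u w s) - G s 0‖ + ‖G s 0‖ := by
        simpa using norm_add_le (G s (u w s) - G s 0) (G s 0)
      have h4 : 1 ≤ Real.exp (μ * s) := Real.one_le_exp (mul_nonneg hμ.le hs.1.le)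
      have h5 : C ≤ C * Real.exp (μ * s) := le_mul_of_one_le_right hC0 h4
      rw [sub_zero] at h1
      have h6 : (K : ℝ) * ‖u w s‖ ≤ K * (Real.exp (μ * s) * ‖w‖) := by gcongr
      have := hC s
      nlinarith
  let Φ (w : BoundedContinuousFunction ℝ E) : BoundedContinuousFunction ℝ E :=
    BoundedContinuousFunction.ofNormedAddCommGroup (T w) (hTc w) _ (hTb w)
  have hΦ : ContractingWith (K / (K + 1)) Φ := by
    refine ⟨?_, LipschitzWith.of_dist_le_mul fun w₁ w₂ => ?_⟩
    · rw [div_lt_one (by positivity)]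
      exact lt_add_one K
    · rw [BoundedContinuousFunction.dist_le (by positivity)]
      intro t
      have e : Φ w₁ t - Φ w₂ t = Real.exp (-(μ * max t 0)) •
          ∫ s in (0 : ℝ)..(max t 0), (G s (u w₁ s) - G s (u w₂ s)) := by
        rw [intervalIntegral.integral_sub ((hGu w₁).intervalIntegrable _ _)
          ((hGu w₂).intervalIntegrable _ _)]
        change Real.exp (-(μ * max t 0)) • (v + ∫ s in (0 : ℝ)..(max t 0), G s (u w₁ s)) -
          Real.exp (-(μ * max t 0)) • (v + ∫ s in (0 : ℝ)..(max t 0), G s (u w₂ s)) = _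
        rw [← smul_sub, add_sub_add_left_eq_sub]
      rw [dist_eq_norm, e]
      refine (norm_exp_smul_integral_le hμ (B := K * dist w₁ w₂) (le_max_right _ _)
        (by positivity) fun s _ => ?_).trans_eq ?_
      · refine ((hK s).norm_sub_le _ _).trans ?_
        have : u w₁ s - u w₂ s = Real.exp (μ * s) • (w₁ s - w₂ s) := (smul_sub _ _ _).symm
        rw [this, norm_smul, Real.norm_eq_abs, Real.abs_exp, ← dist_eq_norm]
        have := w₁.dist_coe_le_dist (g := w₂) s
        calc (K : ℝ) * (Real.exp (μ * s) * dist (w₁ s) (w₂ s))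
            ≤ K * (Real.exp (μ * s) * dist w₁ w₂) := by gcongr
          _ = _ := by ring
      · push_cast
        rw [hμdef]
        ring
  set w := hΦ.fixedPoint Φ with hw
  have hfix : Φ w = w := hΦ.fixedPoint_isFixedPt
  have hform (t : ℝ) (ht : 0 ≤ t) : u w t = v + ∫ s in (0 : ℝ)..t, G s (u w s) := by
    have h1 : w t = Real.exp (-(μ * max t 0)) •
        (v + ∫ s in (0 : ℝ)..(max t 0), G s (u w s)) := by
      conv_lhs => rw [← hfix]
      rfl
    rw [max_eq_left ht] at h1
    change Real.exp (μ * t) • w t = _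
    rw [h1, smul_smul, ← Real.exp_add]
    simp
  refine ⟨u w, by simpa using hform 0 le_rfl, fun t ht => ?_⟩
  have h1 : HasDerivAt (fun t => v + ∫ s in (0 : ℝ)..t, G s (u w s)) (G t (u w t)) t :=
    (intervalIntegral.integral_hasDerivAt_right ((hGu w).intervalIntegrable _ _)
      ((hGu w).stronglyMeasurableAtFilter _ _) (hGu w).continuousAt).const_add v
  exact h1.hasDerivWithinAt.congr (fun x hx => hform x hx) (hform t ht)

end GlobalODE

/-! ### Weighted quadratic forms on `ℓ₂` -/

namespace EllTwo

theorem hasSum_sq (u : EllTwo) : HasSum (fun i => u i ^ 2) (‖u‖ ^ 2) := by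
  have h := lp.hasSum_inner (𝕜 := ℝ) u u
  rw [real_inner_self_eq_norm_sq] at h
  simpa [sq] using h

theorem norm_le_mul_of_abs_le {u w : EllTwo} {c : ℝ} (hc : 0 ≤ c)
    (h : ∀ i, |u i| ≤ c * |w i|) : ‖u‖ ≤ c * ‖w‖ := by
  refine abs_le_of_sq_le_sq' ?_ (by positivity) |>.2
  rw [mul_pow]
  refine hasSum_le (fun i => ?_) (hasSum_sq u) ((hasSum_sq w).mul_left (c ^ 2))
  calc u i ^ 2 = |u i| ^ 2 := (sq_abs _).symm
    _ ≤ (c * |w i|) ^ 2 := by gcongr; exact h i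
    _ = c ^ 2 * w i ^ 2 := by rw [mul_pow, sq_abs]

theorem shift_apply (n : ℤ) (u : EllTwo) (i : ℤ) : shift n u i = u (i + n) := rfl

theorem norm_shift (n : ℤ) (u : EllTwo) : ‖shift n u‖ = ‖u‖ := by
  have h : HasSum (fun i => shift n u i ^ 2) (‖u‖ ^ 2) :=
    ((Equiv.addRight n).hasSum_iff.2 (hasSum_sq u)).congr_fun fun i => by
      rw [Function.comp_apply, shift_apply, Equiv.coe_addRight]
  have h2 : ‖shift n u‖ ^ 2 = ‖u‖ ^ 2 := (hasSum_sq (shift n u)).unique h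
  exact (sq_eq_sq₀ (norm_nonneg _) (norm_nonneg _)).1 h2

theorem shift_sub (n : ℤ) (u w : EllTwo) : shift n (u - w) = shift n u - shift n w := rfl

/-- The weighted sum `∑ ρ i * u i ^ 2`. -/
noncomputable def weightedSq (ρ : ℤ → ℝ) (u : EllTwo) : ℝ := ∑' i, ρ i * u i ^ 2

variable {ρ : ℤ → ℝ}

theorem hasSum_weightedSq (hρ : ∀ i, ρ i ∈ Set.Icc (0 : ℝ) 1) (u : EllTwo) :
    HasSum (fun i => ρ i * u i ^ 2) (weightedSq ρ u) :=
  (Summable.of_nonneg_of_le (fun i => mul_nonneg (hρ i).1 (sq_nonneg _))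
    (fun i => mul_le_of_le_one_left (sq_nonneg _) (hρ i).2) (hasSum_sq u).summable).hasSum

theorem weightedSq_nonneg (hρ : ∀ i, ρ i ∈ Set.Icc (0 : ℝ) 1) (u : EllTwo) :
    0 ≤ weightedSq ρ u :=
  tsum_nonneg fun i => mul_nonneg (hρ i).1 (sq_nonneg _)

theorem weightedSq_one (u : EllTwo) : weightedSq (fun _ => 1) u = ‖u‖ ^ 2 := by
  simpa [weightedSq] using (hasSum_sq u).tsum_eq

/-- Multiplication by a weight with values in `[0, 1]`. -/
noncomputable def weightMul (ρ : ℤ → ℝ) (hρ : ∀ i, ρ i ∈ Set.Icc (0 : ℝ) 1) :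
    EllTwo →L[ℝ] EllTwo :=
  LinearMap.mkContinuous
    { toFun := fun u => ⟨fun i => ρ i * u i, (memEllTwo_iff _).2 <| by
        refine Summable.of_nonneg_of_le (fun i => sq_nonneg _) (fun i => ?_) (hasSum_sq u).summable
        rw [mul_pow]
        exact mul_le_of_le_one_left (sq_nonneg _) (pow_le_one₀ (hρ i).1 (hρ i).2)⟩
      map_add' := fun u w => by ext i; exact mul_add _ _ _
      map_smul' := fun a u => by ext i; exact mul_left_comm _ _ _ } 1
    (fun u => norm_le_mul_of_abs_le zero_le_one fun i => by
      change |ρ i * u i| ≤ 1 * |u i|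
      rw [abs_mul, abs_of_nonneg (hρ i).1]
      exact mul_le_mul_of_nonneg_right (hρ i).2 (abs_nonneg _))

theorem weightMul_apply (hρ : ∀ i, ρ i ∈ Set.Icc (0 : ℝ) 1) (u : EllTwo) (i : ℤ) :
    weightMul ρ hρ u i = ρ i * u i := rfl

theorem hasSum_inner_weightMul (hρ : ∀ i, ρ i ∈ Set.Icc (0 : ℝ) 1) (u w : EllTwo) :
    HasSum (fun i => ρ i * u i * w i) (inner ℝ (weightMul ρ hρ u) w) := by
  have h := lp.hasSum_inner (𝕜 := ℝ) (weightMul ρ hρ u) w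
  refine h.congr_fun fun i => ?_
  rw [weightMul_apply]
  simp [mul_comm]

theorem weightedSq_eq_inner (hρ : ∀ i, ρ i ∈ Set.Icc (0 : ℝ) 1) (u : EllTwo) :
    weightedSq ρ u = inner ℝ (weightMul ρ hρ u) u := by
  refine (hasSum_weightedSq hρ u).unique ((hasSum_inner_weightMul hρ u u).congr_fun fun i => ?_)
  ring

theorem inner_weightMul_comm (hρ : ∀ i, ρ i ∈ Set.Icc (0 : ℝ) 1) (u w : EllTwo) :
    inner ℝ (weightMul ρ hρ u) w = inner ℝ u (weightMul ρ hρ w) := by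
  rw [real_inner_comm (weightMul ρ hρ w) u]
  refine (hasSum_inner_weightMul hρ u w).unique
    ((hasSum_inner_weightMul hρ w u).congr_fun fun i => ?_)
  ring

theorem continuous_weightedSq (hρ : ∀ i, ρ i ∈ Set.Icc (0 : ℝ) 1) :
    Continuous (weightedSq ρ) := by
  have : weightedSq ρ = fun u => inner ℝ (weightMul ρ hρ u) u :=
    funext (weightedSq_eq_inner hρ)
  rw [this]
  exact (weightMul ρ hρ).continuous.inner continuous_id

theorem _root_.HasDerivWithinAt.weightedSq (hρ : ∀ i, ρ i ∈ Set.Icc (0 : ℝ) 1) {u : ℝ → EllTwo}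
    {u' : EllTwo} {s : Set ℝ} {t : ℝ} (hu : HasDerivWithinAt u u' s t) :
    HasDerivWithinAt (fun t => weightedSq ρ (u t)) (2 * inner ℝ (weightMul ρ hρ (u t)) u') s t := by
  have hD : HasDerivWithinAt (fun t => weightMul ρ hρ (u t)) (weightMul ρ hρ u') s t :=
    (weightMul ρ hρ).hasFDerivAt.comp_hasDerivWithinAt t hu
  have e : 2 * inner ℝ (weightMul ρ hρ (u t)) u' =
      inner ℝ (weightMul ρ hρ (u t)) u' + inner ℝ (weightMul ρ hρ u') (u t) := by
    rw [inner_weightMul_comm hρ u' (u t), real_inner_comm u']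
    ring
  simp only [weightedSq_eq_inner hρ, e]
  exact hD.inner ℝ hu

theorem weightedSq_sub_le (hρ : ∀ i, ρ i ∈ Set.Icc (0 : ℝ) 1) (u w : EllTwo) :
    weightedSq ρ (u - w) ≤ 2 * weightedSq ρ u + 2 * weightedSq ρ w := by
  refine hasSum_le (fun i => ?_) (hasSum_weightedSq hρ (u - w))
    (((hasSum_weightedSq hρ u).mul_left 2).add ((hasSum_weightedSq hρ w).mul_left 2))
  change ρ i * (u i - w i) ^ 2 ≤ _
  nlinarith [mul_nonneg (hρ i).1 (sq_nonneg (u i + w i))]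

/-! ### The energy inequality -/

/-- A weight with values in `[0, 1]` on which `ν` times the discrete Laplace operator is at most
`lam / 2`. -/
structure IsLatticeWeight (ν lam : ℝ) (ρ : ℤ → ℝ) : Prop where
  mem_Icc : ∀ i, ρ i ∈ Set.Icc (0 : ℝ) 1
  laplacian_le : ∀ i, ν * (ρ (i - 1) - 2 * ρ i + ρ (i + 1)) ≤ lam / 2 * ρ i

/-- Pointwise, `2 u i (Λu) i` is `u (i+1)² - 2 (u i)² + u (i-1)²` minus two squares, and index
shifts move this second difference onto `ρ`. Of the damping `-2 lam`, one `lam / 2` pays for the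
Laplacian of the weight and another for Young's inequality on `2 u g`. -/
theorem two_mul_inner_weightMul_le {ν lam : ℝ} (hν : 0 ≤ ν) (hlam : 0 < lam)
    (hρ : IsLatticeWeight ν lam ρ) (u w g : EllTwo) (huw : ∀ i, u i * w i ≤ 0) :
    2 * inner ℝ (weightMul ρ hρ.mem_Icc u) (ν • discreteLaplacian u - lam • u + w + g) ≤
      -lam * weightedSq ρ u + 2 / lam * weightedSq ρ g := by
  have hm : ∀ i, ρ (i - 1) ∈ Set.Icc (0 : ℝ) 1 := fun i => hρ.mem_Icc _
  have hp : ∀ i, ρ (i + 1) ∈ Set.Icc (0 : ℝ) 1 := fun i => hρ.mem_Icc _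
  have h0 := hasSum_weightedSq hρ.mem_Icc u
  have hg := hasSum_weightedSq hρ.mem_Icc g
  have h1 : HasSum (fun i => ρ i * u (i + 1) ^ 2) (weightedSq (fun i => ρ (i - 1)) u) := by
    refine ((Equiv.addRight (1 : ℤ)).hasSum_iff.2 (hasSum_weightedSq hm u)).congr_fun fun i => ?_
    simp
  have h2 : HasSum (fun i => ρ i * u (i - 1) ^ 2) (weightedSq (fun i => ρ (i + 1)) u) := by
    refine ((Equiv.subRight (1 : ℤ)).hasSum_iff.2 (hasSum_weightedSq hp u)).congr_fun fun i => ?_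
    simp
  have h3 : ν * (weightedSq (fun i => ρ (i - 1)) u - 2 * weightedSq ρ u
      + weightedSq (fun i => ρ (i + 1)) u) ≤ lam / 2 * weightedSq ρ u := by
    refine hasSum_le (fun i => ?_) ((((hasSum_weightedSq hm u).sub (h0.mul_left 2)).add
      (hasSum_weightedSq hp u)).mul_left ν) (h0.mul_left (lam / 2))
    have := mul_le_mul_of_nonneg_right (hρ.laplacian_le i) (sq_nonneg (u i))
    nlinarith
  have h4 : 2 * inner ℝ (weightMul ρ hρ.mem_Icc u) (ν • discreteLaplacian u - lam • u + w + g) ≤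
      ν * (weightedSq (fun i => ρ (i - 1)) u - 2 * weightedSq ρ u
        + weightedSq (fun i => ρ (i + 1)) u) + (-(3 * lam / 2)) * weightedSq ρ u
        + 2 / lam * weightedSq ρ g := by
    refine hasSum_le (fun i => ?_) ((hasSum_inner_weightMul hρ.mem_Icc u _).mul_left 2)
      (((((h1.sub (h0.mul_left 2)).add h2).mul_left ν).add (h0.mul_left (-(3 * lam / 2)))).add
        (hg.mul_left (2 / lam)))
    change 2 * (ρ i * u i * (ν * (u (i + -1) - 2 * u i + u (i + 1)) - lam * u i + w i + g i)) ≤ _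
    rw [← sub_eq_add_neg]
    have hr := (hρ.mem_Icc i).1
    have e1 : 0 ≤ ν * ρ i * ((u i - u (i + 1)) ^ 2 + (u i - u (i - 1)) ^ 2) := by positivity
    have e2 : ρ i * (u i * w i) ≤ 0 := mul_nonpos_of_nonneg_of_nonpos hr (huw i)
    have e3 : 0 ≤ ρ i * (lam / 2 * (u i - 2 / lam * g i) ^ 2) := by positivity
    have e4 : ρ i * (lam / 2 * (u i - 2 / lam * g i) ^ 2) =
        ρ i * (lam / 2 * u i ^ 2 - 2 * u i * g i + 2 / lam * g i ^ 2) := by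
      field_simp
      ring
    rw [e4] at e3
    linarith
  linarith

/-- Exponential decay of weighted norms along solutions of the lattice equation. -/
theorem weightedSq_solution_le {ν lam : ℝ} (hν : 0 ≤ ν) (hlam : 0 < lam)
    (hρ : IsLatticeWeight ν lam ρ) {u w g : ℝ → EllTwo} {T a : ℝ}
    (hc : ContinuousOn u (Set.Icc 0 T))
    (hu : ∀ t ∈ Set.Ico 0 T, HasDerivWithinAt u
      (ν • discreteLaplacian (u t) - lam • u t + w t + g t) (Set.Ici t) t)
    (huw : ∀ t i, u t i * w t i ≤ 0) (ha : ∀ t, weightedSq ρ (g t) ≤ a) :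
    ∀ t ∈ Set.Icc 0 T, weightedSq ρ (u t) ≤ Real.exp (-lam * t) * weightedSq ρ (u 0) +
      (1 - Real.exp (-lam * t)) * (2 / lam ^ 2 * a) := by
  intro t ht
  have h := le_gronwallBound_of_liminf_deriv_right_le (K := -lam) (ε := 2 / lam * a)
    ((continuous_weightedSq hρ.mem_Icc).comp_continuousOn hc)
    (fun x hx r hr => ((hu x hx).weightedSq hρ.mem_Icc).liminf_right_slope_le hr) le_rfl
    (fun x hx => (two_mul_inner_weightMul_le hν hlam hρ (u x) (w x) (g x) (huw x)).trans
      (add_le_add_right (mul_le_mul_of_nonneg_left (ha x) (by positivity)) _)) t ht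
  rw [gronwallBound_of_K_ne_0 (neg_ne_zero.2 hlam.ne'), sub_zero] at h
  refine h.trans_eq ?_
  simp only [Function.comp]
  field_simp
  ring

/-! ### Tail weights and compact sets -/

/-- Weights which are `1` far from the origin and decrease to `0` with `k`. -/
noncomputable def tailWeight (c : ℝ) (k : ℕ) (i : ℤ) : ℝ := min 1 ((|(i : ℝ)| + c) / (k + 1))

variable {c : ℝ}

theorem tailWeight_mem_Icc (hc : 1 ≤ c) (k : ℕ) (i : ℤ) :
    tailWeight c k i ∈ Set.Icc (0 : ℝ) 1 :=
  ⟨le_min zero_le_one (by positivity), min_le_left _ _⟩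

theorem tailWeight_zero (hc : 1 ≤ c) : tailWeight c 0 = fun _ => 1 := by
  ext i
  have := abs_nonneg (i : ℝ)
  simp only [tailWeight, Nat.cast_zero, zero_add, div_one]
  exact min_eq_left (by linarith)

/-- Where the weight attains its maximum `1`, its second difference is non-positive. Elsewhere that
of `|i|` is at most `2`, and `2 ν ≤ (lam / 2) c` is the hypothesis on `c`. -/
theorem isLatticeWeight_tailWeight {ν lam : ℝ} (hν : 0 ≤ ν) (hlam : 0 < lam) (hc : 1 ≤ c)
    (hc' : 4 * ν ≤ lam * c) (k : ℕ) : IsLatticeWeight ν lam (tailWeight c k) := by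
  refine ⟨tailWeight_mem_Icc hc k, fun i => ?_⟩
  have hk : (0 : ℝ) < k + 1 := by positivity
  have hm : tailWeight c k (i - 1) ≤ 1 := min_le_left _ _
  have hp : tailWeight c k (i + 1) ≤ 1 := min_le_left _ _
  rcases le_total 1 ((|(i : ℝ)| + c) / (k + 1)) with h | h
  · have h0 : tailWeight c k i = 1 := min_eq_left h
    rw [h0]
    have : ν * (tailWeight c k (i - 1) - 2 * 1 + tailWeight c k (i + 1)) ≤ 0 :=
      mul_nonpos_of_nonneg_of_nonpos hν (by linarith)
    linarith
  · have h0 : tailWeight c k i = (|(i : ℝ)| + c) / (k + 1) := min_eq_right h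
    have am : |((i - 1 : ℤ) : ℝ)| ≤ |(i : ℝ)| + 1 := by
      push_cast
      simpa using abs_sub (i : ℝ) 1
    have ap : |((i + 1 : ℤ) : ℝ)| ≤ |(i : ℝ)| + 1 := by
      push_cast
      simpa using abs_add_le (i : ℝ) 1
    have hm' : tailWeight c k (i - 1) ≤ (|(i : ℝ)| + 1 + c) / (k + 1) :=
      (min_le_right _ _).trans (by gcongr)
    have hp' : tailWeight c k (i + 1) ≤ (|(i : ℝ)| + 1 + c) / (k + 1) :=
      (min_le_right _ _).trans (by gcongr)
    rw [h0]
    calc ν * (tailWeight c k (i - 1) - 2 * ((|(i : ℝ)| + c) / (k + 1)) + tailWeight c k (i + 1))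
        ≤ ν * ((|(i : ℝ)| + 1 + c) / (k + 1) - 2 * ((|(i : ℝ)| + c) / (k + 1))
            + (|(i : ℝ)| + 1 + c) / (k + 1)) := by gcongr
      _ = 2 * ν / (k + 1) := by field_simp; ring
      _ ≤ lam / 2 * (|(i : ℝ)| + c) / (k + 1) := by
          refine div_le_div_of_nonneg_right ?_ hk.le
          nlinarith [mul_nonneg hlam.le (abs_nonneg (i : ℝ))]
      _ = _ := by ring

theorem tailWeight_antitone (hc : 1 ≤ c) (i : ℤ) : Antitone fun k => tailWeight c k i := by
  intro k l hkl
  refine min_le_min_left _ ?_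
  gcongr

theorem tendsto_tailWeight (c : ℝ) (i : ℤ) :
    Filter.Tendsto (fun k => tailWeight c k i) Filter.atTop (𝓝 0) := by
  have h : Filter.Tendsto (fun k : ℕ => (|(i : ℝ)| + c) * (1 / ((k : ℝ) + 1))) Filter.atTop
      (𝓝 ((|(i : ℝ)| + c) * 0)) := tendsto_one_div_add_atTop_nhds_zero_nat.const_mul _
  have h' := (tendsto_const_nhds (x := (1 : ℝ))).min h
  simpa [tailWeight, div_eq_mul_inv] using h'

theorem tendsto_weightedSq_tailWeight (hc : 1 ≤ c) (u : EllTwo) :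
    Filter.Tendsto (fun k => weightedSq (tailWeight c k) u) Filter.atTop (𝓝 0) := by
  have h := tendsto_tsum_of_dominated_convergence (f := fun k i => tailWeight c k i * u i ^ 2)
    (g := fun _ => (0 : ℝ)) (𝓕 := Filter.atTop) (hasSum_sq u).summable
    (fun i => by simpa using (tendsto_tailWeight c i).mul_const (u i ^ 2))
    (Filter.Eventually.of_forall fun k i => by
      have := tailWeight_mem_Icc hc k i
      rw [Real.norm_of_nonneg (mul_nonneg this.1 (sq_nonneg _))]
      exact mul_le_of_le_one_left (sq_nonneg _) this.2)
  simpa [weightedSq] using h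

theorem weightedSq_tailWeight_antitone (hc : 1 ≤ c) (u : EllTwo) :
    Antitone fun k => weightedSq (tailWeight c k) u := fun k l hkl =>
  hasSum_le (fun i => mul_le_mul_of_nonneg_right (tailWeight_antitone hc i hkl) (sq_nonneg _))
    (hasSum_weightedSq (tailWeight_mem_Icc hc l) u) (hasSum_weightedSq (tailWeight_mem_Icc hc k) u)

/-- Dini's theorem: the weighted sums are continuous and decrease pointwise to `0`. -/
theorem exists_tail_bound (hc : 1 ≤ c) {M : Set EllTwo} (hM : IsCompact M) :
    ∃ m : ℕ → ℝ, (∀ k, 0 ≤ m k) ∧ Filter.Tendsto m Filter.atTop (𝓝 0) ∧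
      ∀ k, ∀ u ∈ M, weightedSq (tailWeight c k) u ≤ m k := by
  have hunif : TendstoUniformlyOn (fun k u => weightedSq (tailWeight c k) u) (fun _ => (0 : ℝ))
      Filter.atTop M :=
    Antitone.tendstoUniformlyOn_of_forall_tendsto hM
      (fun k => (continuous_weightedSq (tailWeight_mem_Icc hc k)).continuousOn)
      (fun u _ => weightedSq_tailWeight_antitone hc u) continuousOn_const
      (fun u _ => tendsto_weightedSq_tailWeight hc u)
  have hnn : ∀ k, 0 ≤ sSup (weightedSq (tailWeight c k) '' M) := fun k =>
    Real.sSup_nonneg (by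
      rintro _ ⟨u, -, rfl⟩
      exact weightedSq_nonneg (tailWeight_mem_Icc hc k) u)
  refine ⟨fun k => sSup (weightedSq (tailWeight c k) '' M), hnn, ?_, fun k u hu =>
    le_csSup (hM.image (continuous_weightedSq (tailWeight_mem_Icc hc k))).bddAbove ⟨u, hu, rfl⟩⟩
  rw [Metric.tendsto_atTop']
  intro ε hε
  obtain ⟨N, hN⟩ := Filter.eventually_atTop.1
    (Metric.tendstoUniformlyOn_iff.1 hunif (ε / 2) (half_pos hε))
  refine ⟨N, fun k hk => ?_⟩
  rw [Real.dist_eq, sub_zero, abs_of_nonneg (hnn k)]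
  refine (Real.sSup_le ?_ (half_pos hε).le).trans_lt (half_lt_self hε)
  rintro _ ⟨u, hu, rfl⟩
  have := hN k hk.le u hu
  rw [dist_comm, Real.dist_eq, sub_zero] at this
  exact (le_abs_self _).trans this.le

theorem norm_sq_le_sum_add_tail (hc : 1 ≤ c) (k : ℕ) (u : EllTwo) :
    ‖u‖ ^ 2 ≤ ∑ i ∈ Finset.Icc (-(k : ℤ)) k, u i ^ 2 + weightedSq (tailWeight c k) u := by
  have h1 : HasSum (fun i => if i ∈ Finset.Icc (-(k : ℤ)) k then u i ^ 2 else 0)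
      (∑ i ∈ Finset.Icc (-(k : ℤ)) k, u i ^ 2) := by
    have := hasSum_sum_of_ne_finset_zero (f := fun i =>
      if i ∈ Finset.Icc (-(k : ℤ)) k then u i ^ 2 else 0) (s := Finset.Icc (-(k : ℤ)) k)
      (L := SummationFilter.unconditional ℤ) (fun i hi => if_neg hi)
    rwa [Finset.sum_congr rfl fun i hi => if_pos hi] at this
  refine hasSum_le (fun i => ?_) (hasSum_sq u)
    (h1.add (hasSum_weightedSq (tailWeight_mem_Icc hc k) u))
  have h0 := mul_nonneg (tailWeight_mem_Icc hc k i).1 (sq_nonneg (u i))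
  split_ifs with hi
  · linarith
  · have hi' : (k : ℤ) + 1 ≤ |i| := by
      rw [Finset.mem_Icc, ← abs_le] at hi
      omega
    have hi'' : (k : ℝ) + 1 ≤ |(i : ℝ)| := by exact_mod_cast hi'
    have : tailWeight c k i = 1 := by
      refine min_eq_left ?_
      rw [one_le_div (by positivity)]
      linarith
    rw [this]
    linarith

/-- A closed set of sequences with uniformly small weighted tails is compact. -/
theorem isCompact_setOf_weightedSq_tailWeight_le (hc : 1 ≤ c) {b : ℕ → ℝ}
    (hb : Filter.Tendsto b Filter.atTop (𝓝 0)) :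
    IsCompact {u : EllTwo | ∀ k, weightedSq (tailWeight c k) u ≤ b k} := by
  set S := {u : EllTwo | ∀ k, weightedSq (tailWeight c k) u ≤ b k} with hS
  have hcl : IsClosed S := by
    rw [hS, Set.ofPred_forall]
    exact isClosed_iInter fun k =>
      isClosed_le (continuous_weightedSq (tailWeight_mem_Icc hc k)) continuous_const
  rw [isCompact_iff_totallyBounded_isComplete]
  -- Every ultrafilter on `S` is Cauchy: each coordinate converges along it, and the tails are
  -- uniformly small.
  refine ⟨totallyBounded_iff_ultrafilter.2 fun U hU => ?_, hcl.isComplete⟩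
  have hUS : ∀ᶠ u in (U : Filter EllTwo), u ∈ S := Filter.le_principal_iff.1 hU
  have hlim : ∀ i, ∃ x, Filter.Tendsto (fun u : EllTwo => u i) U (𝓝 x) := by
    intro i
    obtain ⟨x, -, hx⟩ := (isCompact_closedBall (0 : ℝ) (Real.sqrt (b 0))).ultrafilter_le_nhds
      (U.map fun u : EllTwo => u i) (by
        refine Filter.le_principal_iff.2 (Filter.mem_map.2 ?_)
        filter_upwards [hUS] with u hu
        have h0 := hu 0
        -- For `k = 0` the weight is identically `1`, so the tail bound is a norm bound.
        rw [tailWeight_zero hc, weightedSq_one] at h0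
        change u i ∈ Metric.closedBall (0 : ℝ) (Real.sqrt (b 0))
        rw [mem_closedBall_zero_iff]
        exact (lp.norm_apply_le_norm (by norm_num) u i).trans (Real.le_sqrt_of_sq_le h0))
    exact ⟨x, hx⟩
  choose x hx using hlim
  refine ⟨U.neBot, Metric.uniformity_basis_dist.ge_iff.2 fun ε hε => ?_⟩
  -- The tail of a difference of two members of `S` is at most `2 b k + 2 b k`, hence the threshold
  -- `ε² / 4`.
  obtain ⟨k, hk⟩ := (hb.eventually (gt_mem_nhds (show (0 : ℝ) < ε ^ 2 / 4 by positivity))).exists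
  have hsum : Filter.Tendsto (fun p : EllTwo × EllTwo =>
      ∑ i ∈ Finset.Icc (-(k : ℤ)) k, (p.1 i - p.2 i) ^ 2)
      ((U : Filter EllTwo) ×ˢ (U : Filter EllTwo)) (𝓝 0) := by
    have := tendsto_finsetSum (Finset.Icc (-(k : ℤ)) k) fun i _ =>
      ((((hx i).comp Filter.tendsto_fst).sub ((hx i).comp Filter.tendsto_snd)).pow 2 :
        Filter.Tendsto _ ((U : Filter EllTwo) ×ˢ (U : Filter EllTwo)) _)
    simpa using this
  filter_upwards [hsum.eventually (gt_mem_nhds (show (0 : ℝ) < ε ^ 2 - 4 * b k by linarith)),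
    Filter.tendsto_fst.eventually hUS, Filter.tendsto_snd.eventually hUS] with p hp h1 h2
  rw [dist_eq_norm]
  refine lt_of_pow_lt_pow_left₀ 2 hε.le ?_
  have e1 := norm_sq_le_sum_add_tail hc k (p.1 - p.2)
  have e2 := weightedSq_sub_le (tailWeight_mem_Icc hc k) p.1 p.2
  have e3 := h1 k
  have e4 := h2 k
  have e5 : ∑ i ∈ Finset.Icc (-(k : ℤ)) k, (p.1 - p.2) i ^ 2 =
    ∑ i ∈ Finset.Icc (-(k : ℤ)) k, (p.1 i - p.2 i) ^ 2 := rfl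
  linarith

end EllTwo

/-! ### Truncation of the nonlinearity -/

/-- `F` composed with the retraction of `ℝ` onto `[-R, R]`. -/
def truncation (F : ℝ → ℝ) (R s : ℝ) : ℝ := F (max (-R) (min R s))

theorem truncation_of_abs_le (F : ℝ → ℝ) {R s : ℝ} (hs : |s| ≤ R) : truncation F R s = F s := by
  obtain ⟨h1, h2⟩ := abs_le.1 hs
  rw [truncation, min_eq_right h2, max_eq_right h1]

theorem truncation_zero {F : ℝ → ℝ} (hF0 : F 0 = 0) {R : ℝ} (hR : 0 < R) :
    truncation F R 0 = 0 := by
  rw [truncation_of_abs_le F (by simpa using hR.le), hF0]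

/-- Outside `[-R, R]` the value is `F R` or `F (-R)`, and `s` has the sign of the corresponding
endpoint. -/
theorem mul_truncation_nonpos {F : ℝ → ℝ} (hF : ∀ s, s * F s ≤ 0) {R : ℝ} (hR : 0 < R) (s : ℝ) :
    s * truncation F R s ≤ 0 := by
  rcases le_or_gt |s| R with h | h
  · rw [truncation_of_abs_le F h]
    exact hF s
  · rcases lt_abs.1 h with h' | h'
    · rw [truncation, min_eq_left h'.le, max_eq_right (by linarith)]
      nlinarith [hF R, nonpos_of_mul_nonpos_right (hF R) hR]
    · rw [truncation, min_eq_right (by linarith), max_eq_left (by linarith)]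
      nlinarith [hF (-R)]

theorem LipschitzOnBounded.exists_lipschitzWith_truncation {F : ℝ → ℝ}
    (hF : LipschitzOnBounded F) {R : ℝ} (hR : 0 < R) : ∃ L, LipschitzWith L (truncation F R) := by
  obtain ⟨L, hL⟩ := hF (Set.Icc (-R) R) (Metric.isBounded_Icc _ _)
  have h1 : LipschitzWith 1 fun s : ℝ => max (-R) (min R s) :=
    (LipschitzWith.id.const_min R).const_max (-R)
  refine ⟨L * 1, lipschitzOnWith_univ.1 (hL.comp (h1.lipschitzOnWith (s := Set.univ)) ?_)⟩
  intro s _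
  exact ⟨le_max_left _ _, max_le (by linarith) (min_le_left _ _)⟩

theorem LipschitzWith.lipschitzOnBounded {F : ℝ → ℝ} {L : ℝ≥0} (hF : LipschitzWith L F) :
    LipschitzOnBounded F := fun _ _ => ⟨L, hF.lipschitzOnWith⟩

/-! ### Lipschitz estimates for the lattice vector field -/

theorem lipschitzWith_discreteLaplacian : LipschitzWith 4 discreteLaplacian := by
  refine LipschitzWith.of_dist_le_mul fun u w => ?_
  rw [dist_eq_norm, dist_eq_norm]
  have e : discreteLaplacian u - discreteLaplacian w =
      EllTwo.shift (-1) (u - w) - (2 : ℝ) • (u - w) + EllTwo.shift 1 (u - w) := by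
    simp only [discreteLaplacian, EllTwo.shift_sub, smul_sub]
    abel
  rw [e]
  refine (norm_add_le _ _).trans ?_
  have h := norm_sub_le (EllTwo.shift (-1) (u - w)) ((2 : ℝ) • (u - w))
  rw [norm_smul, EllTwo.norm_shift] at h
  rw [EllTwo.norm_shift]
  norm_num at h ⊢
  linarith

theorem LipschitzWith.nemytskii {F : ℝ → ℝ} {L : ℝ≥0} (hL : LipschitzWith L F)
    (hF : LipschitzOnBounded F) (hF0 : F 0 = 0) : LipschitzWith L (nemytskii F hF hF0) := by
  refine LipschitzWith.of_dist_le_mul fun u w => ?_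
  rw [dist_eq_norm, dist_eq_norm]
  exact EllTwo.norm_le_mul_of_abs_le L.2 fun i => hL.norm_sub_le _ _

theorem exists_lipschitzWith_latticeField (ν lam : ℝ) {F : ℝ → ℝ} {L : ℝ≥0}
    (hL : LipschitzWith L F) (hF : LipschitzOnBounded F) (hF0 : F 0 = 0) :
    ∃ K, LipschitzWith K fun u : EllTwo =>
      ν • discreteLaplacian u - lam • u + nemytskii F hF hF0 u :=
  ⟨_, (((lipschitzWith_smul ν).comp lipschitzWith_discreteLaplacian).sub
    (lipschitzWith_smul lam)).add (hL.nemytskii hF hF0)⟩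

theorem nemytskii_truncation {F : ℝ → ℝ} (hF : LipschitzOnBounded F) (hF0 : F 0 = 0) {R : ℝ}
    (hT : LipschitzOnBounded (truncation F R)) (hT0 : truncation F R 0 = 0) {u : EllTwo}
    (hu : ‖u‖ ≤ R) : nemytskii (truncation F R) hT hT0 u = nemytskii F hF hF0 u := by
  ext i
  exact truncation_of_abs_le F ((lp.norm_apply_le_norm (by norm_num) u i).trans hu)

/-! ### Solutions of the lattice equation -/

section Solutions

variable {ν lam : ℝ} {F : ℝ → ℝ} {hF : LipschitzOnBounded F} {hF0 : F 0 = 0}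
  {g : C(ℝ, EllTwo)} {J : Set ℝ} {u : ℝ → EllTwo} {T : ℝ}

theorem IsLatticeSolutionOn.continuousOn (h : IsLatticeSolutionOn ν lam F hF hF0 g J u) :
    ContinuousOn u J := fun t ht => (h t ht).continuousWithinAt

theorem IsLatticeSolutionOn.hasDerivWithinAt_Ici (h : IsLatticeSolutionOn ν lam F hF hF0 g J u)
    (hJ : Set.Icc 0 T ⊆ J) {t : ℝ} (ht : t ∈ Set.Ico 0 T) :
    HasDerivWithinAt u (ν • discreteLaplacian (u t) - lam • u t + nemytskii F hF hF0 (u t) + g t)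
      (Set.Ici t) t :=
  (h t (hJ (Set.Ico_subset_Icc_self ht))).mono_of_mem_nhdsWithin
    (Filter.mem_of_superset (Icc_mem_nhdsGE_of_mem ht) hJ)

theorem IsLatticeSolutionOn.weightedSq_le (h : IsLatticeSolutionOn ν lam F hF hF0 g J u)
    (hν : 0 ≤ ν) (hlam : 0 < lam) (hsign : ∀ s, s * F s ≤ 0) {ρ : ℤ → ℝ}
    (hρ : EllTwo.IsLatticeWeight ν lam ρ) {a : ℝ} (ha : ∀ t, EllTwo.weightedSq ρ (g t) ≤ a)
    (hJ : Set.Icc 0 T ⊆ J) {t : ℝ} (ht : t ∈ Set.Icc 0 T) :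
    EllTwo.weightedSq ρ (u t) ≤ Real.exp (-lam * t) * EllTwo.weightedSq ρ (u 0) +
      (1 - Real.exp (-lam * t)) * (2 / lam ^ 2 * a) :=
  EllTwo.weightedSq_solution_le hν hlam hρ (h.continuousOn.mono hJ)
    (fun _ hs => h.hasDerivWithinAt_Ici hJ hs) (fun _ _ => hsign _) ha t ht

theorem EllTwo.isLatticeWeight_one (hlam : 0 < lam) :
    EllTwo.IsLatticeWeight ν lam fun _ => 1 := by
  refine ⟨fun _ => by simp, fun _ => ?_⟩
  norm_num
  linarith

theorem IsLatticeSolutionOn.norm_sq_le (h : IsLatticeSolutionOn ν lam F hF hF0 g J u)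
    (hν : 0 ≤ ν) (hlam : 0 < lam) (hsign : ∀ s, s * F s ≤ 0) {C : ℝ} (hC : ∀ t, ‖g t‖ ≤ C)
    (hJ : Set.Icc 0 T ⊆ J) {t : ℝ} (ht : t ∈ Set.Icc 0 T) :
    ‖u t‖ ^ 2 ≤ ‖u 0‖ ^ 2 + 2 / lam ^ 2 * C ^ 2 := by
  have h1 := h.weightedSq_le hν hlam hsign (EllTwo.isLatticeWeight_one hlam) (a := C ^ 2)
    (fun t => by
      rw [EllTwo.weightedSq_one]
      exact pow_le_pow_left₀ (norm_nonneg _) (hC t) 2) hJ ht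
  rw [EllTwo.weightedSq_one, EllTwo.weightedSq_one] at h1
  have h2 : Real.exp (-lam * t) ≤ 1 := Real.exp_le_one_iff.2 (by nlinarith [ht.1])
  have h3 : Real.exp (-lam * t) * ‖u 0‖ ^ 2 ≤ ‖u 0‖ ^ 2 :=
    mul_le_of_le_one_left (sq_nonneg _) h2
  have h4 : (1 - Real.exp (-lam * t)) * (2 / lam ^ 2 * C ^ 2) ≤ 2 / lam ^ 2 * C ^ 2 :=
    mul_le_of_le_one_left (by positivity) (by linarith [Real.exp_pos (-lam * t)])
  linarith

/-- The truncated equation is globally Lipschitz and obeys the same a priori bound, since truncation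
keeps the sign condition. With `R` above that bound its solution never meets the truncation. -/
theorem exists_isLatticeSolutionOn_Ici (hν : 0 ≤ ν) (hlam : 0 < lam)
    (hF : LipschitzOnBounded F) (hF0 : F 0 = 0) (hsign : ∀ s, s * F s ≤ 0) {C : ℝ}
    (hC : ∀ t, ‖g t‖ ≤ C) (v : EllTwo) :
    ∃ u : ℝ → EllTwo, u 0 = v ∧ IsLatticeSolutionOn ν lam F hF hF0 g (Set.Ici 0) u := by
  set R : ℝ := Real.sqrt (‖v‖ ^ 2 + 2 / lam ^ 2 * C ^ 2) + 1 with hRdef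
  have hR : 0 < R := by positivity
  obtain ⟨L, hL⟩ := hF.exists_lipschitzWith_truncation hR
  have hT := hL.lipschitzOnBounded
  have hT0 := truncation_zero hF0 hR
  obtain ⟨K, hK⟩ := exists_lipschitzWith_latticeField ν lam hL hT hT0
  have hz : ν • discreteLaplacian 0 - lam • (0 : EllTwo) + nemytskii (truncation F R) hT hT0 0
      = 0 := by
    ext i
    change ν * (0 - 2 * 0 + 0) - lam * 0 + truncation F R 0 = 0
    rw [hT0]
    ring
  obtain ⟨u, hu0, hu⟩ := exists_solution_Ici_of_lipschitzWith
    (G := fun t x => ν • discreteLaplacian x - lam • x + nemytskii (truncation F R) hT hT0 x + g t)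
    (K := K) (C := C)
    ((hK.continuous.comp continuous_snd).add (g.continuous.comp continuous_fst))
    (fun t => LipschitzWith.of_dist_le_mul fun x y => by
      rw [dist_add_right]
      exact hK.dist_le_mul x y)
    (fun t => by rw [hz, zero_add]; exact hC t) v
  have hsol : IsLatticeSolutionOn ν lam (truncation F R) hT hT0 g (Set.Ici 0) u := hu
  refine ⟨u, hu0, fun t ht => ?_⟩
  have hb : ‖u t‖ ≤ R := by
    have h1 := hsol.norm_sq_le hν hlam (mul_truncation_nonpos hsign hR) hC
      (T := t) Set.Icc_subset_Ici_self (Set.right_mem_Icc.2 ht)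
    rw [hu0] at h1
    have := Real.le_sqrt_of_sq_le h1
    linarith
  rw [← nemytskii_truncation hF hF0 hT hT0 hb]
  exact hsol t ht

/-- Continuous dependence of bounded solutions on the initial value and the forcing term. -/
theorem exists_dist_solution_le (ν lam : ℝ) (hF : LipschitzOnBounded F) (hF0 : F 0 = 0) {R : ℝ}
    (hR : 0 < R) : ∃ K : ℝ, 0 < K ∧ ∀ (g₁ g₂ : C(ℝ, EllTwo)) (J₁ J₂ : Set ℝ) (u₁ u₂ : ℝ → EllTwo)
      (T ε : ℝ), IsLatticeSolutionOn ν lam F hF hF0 g₁ J₁ u₁ →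
      IsLatticeSolutionOn ν lam F hF hF0 g₂ J₂ u₂ → Set.Icc 0 T ⊆ J₁ → Set.Icc 0 T ⊆ J₂ →
      (∀ t ∈ Set.Icc 0 T, ‖u₁ t‖ ≤ R) → (∀ t ∈ Set.Icc 0 T, ‖u₂ t‖ ≤ R) → 0 ≤ ε →
      (∀ t ∈ Set.Icc 0 T, dist (g₁ t) (g₂ t) ≤ ε) →
      ∀ t ∈ Set.Icc 0 T, dist (u₁ t) (u₂ t) ≤ (dist (u₁ 0) (u₂ 0) + ε) * Real.exp (K * t) := by
  obtain ⟨L, hL⟩ := hF.exists_lipschitzWith_truncation hR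
  have hT := hL.lipschitzOnBounded
  have hT0 := truncation_zero hF0 hR
  obtain ⟨K, hK⟩ := exists_lipschitzWith_latticeField ν lam hL hT hT0
  -- The enlarged constant is non-zero, as the Gronwall formula requires, and gives `ε / (K + 1) ≤
  -- ε`.
  have hK1 : (1 : ℝ) ≤ (K + 1 : ℝ≥0) := by simp
  refine ⟨(K + 1 : ℝ≥0), by positivity, ?_⟩
  intro g₁ g₂ J₁ J₂ u₁ u₂ T ε h₁ h₂ hJ₁ hJ₂ hb₁ hb₂ hε hg t ht
  -- For the truncated field with forcing `g₁`, `u₁` is an exact trajectory and `u₂` one with defect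
  -- at most `ε`.
  have h := dist_le_of_approx_trajectories_ODE (K := K + 1) (εf := 0) (εg := ε)
    (v := fun t x =>
      ν • discreteLaplacian x - lam • x + nemytskii (truncation F R) hT hT0 x + g₁ t)
    (fun t => LipschitzWith.of_dist_le_mul fun x y => by
      rw [dist_add_right]
      exact (hK.weaken (le_self_add : K ≤ K + 1)).dist_le_mul x y)
    (h₁.continuousOn.mono hJ₁) (fun s hs => h₁.hasDerivWithinAt_Ici hJ₁ hs)
    (fun s hs => by
      rw [nemytskii_truncation hF hF0 hT hT0 (hb₁ s (Set.Ico_subset_Icc_self hs)), dist_self])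
    (h₂.continuousOn.mono hJ₂) (fun s hs => h₂.hasDerivWithinAt_Ici hJ₂ hs)
    (fun s hs => by
      rw [nemytskii_truncation hF hF0 hT hT0 (hb₂ s (Set.Ico_subset_Icc_self hs)), dist_add_left,
        dist_comm]
      exact hg s (Set.Ico_subset_Icc_self hs)) le_rfl t ht
  rw [gronwallBound_of_K_ne_0 (by positivity), sub_zero, zero_add] at h
  refine h.trans ?_
  have h3 : ε / (K + 1 : ℝ≥0) ≤ ε := div_le_self hε hK1
  have h4 : 0 ≤ ε / (K + 1 : ℝ≥0) := by positivity
  have h5 := Real.exp_pos ((K + 1 : ℝ≥0) * t)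
  nlinarith [mul_le_mul_of_nonneg_right h3 h5.le]

theorem IsLatticeSolutionOn.eqOn (hν : 0 ≤ ν) (hlam : 0 < lam) (hsign : ∀ s, s * F s ≤ 0) {C : ℝ}
    (hC : ∀ t, ‖g t‖ ≤ C) {J₁ J₂ : Set ℝ} {u₁ u₂ : ℝ → EllTwo}
    (h₁ : IsLatticeSolutionOn ν lam F hF hF0 g J₁ u₁)
    (h₂ : IsLatticeSolutionOn ν lam F hF hF0 g J₂ u₂) (hJ₁ : Set.Icc 0 T ⊆ J₁)
    (hJ₂ : Set.Icc 0 T ⊆ J₂) (h0 : u₁ 0 = u₂ 0) : Set.EqOn u₁ u₂ (Set.Icc 0 T) := by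
  intro t ht
  set R : ℝ := Real.sqrt (‖u₁ 0‖ ^ 2 + 2 / lam ^ 2 * C ^ 2) + 1 with hRdef
  obtain ⟨K, -, hK⟩ := exists_dist_solution_le ν lam hF hF0 (show 0 < R by positivity)
  have h := hK g g J₁ J₂ u₁ u₂ T 0 h₁ h₂ hJ₁ hJ₂
    (fun s hs => by
      linarith [Real.le_sqrt_of_sq_le (h₁.norm_sq_le hν hlam hsign hC hJ₁ hs)])
    (fun s hs => by
      have := h₂.norm_sq_le hν hlam hsign hC hJ₂ hs
      rw [← h0] at this
      linarith [Real.le_sqrt_of_sq_le this]) le_rfl (fun s _ => by simp) t ht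
  rw [h0, dist_self, add_zero, zero_mul] at h
  exact dist_le_zero.1 h

theorem IsLatticeSolutionOn.shift (h : IsLatticeSolutionOn ν lam F hF hF0 g (Set.Ici 0) u)
    {τ : ℝ} (hτ : 0 ≤ τ) : IsLatticeSolutionOn ν lam F hF hF0 (bebutovFlow EllTwo τ g) (Set.Ici 0)
      fun t => u (t + τ) := by
  intro t ht
  have h1 := h (t + τ) (add_nonneg ht hτ)
  have h2 : HasDerivWithinAt (fun t => t + τ) 1 (Set.Ici 0) t :=
    ((hasDerivAt_id t).add_const τ).hasDerivWithinAt
  have h3 := h1.scomp t h2 (fun s hs => add_nonneg hs hτ)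
  rw [one_smul] at h3
  exact h3

end Solutions

/-! ### The cocycle of the lattice equation -/

/-- The set of values of the elements of the hull. -/
def hullValues (f : C(ℝ, EllTwo)) : Set EllTwo := (fun g : C(ℝ, EllTwo) => g 0) '' hull f

theorem isCompact_hullValues {f : C(ℝ, EllTwo)} (hf : TranslationCompact f) :
    IsCompact (hullValues f) :=
  IsCompact.image hf (continuous_eval_const 0)

theorem apply_mem_hullValues {f : C(ℝ, EllTwo)} (g : hull f) (t : ℝ) :
    (g : C(ℝ, EllTwo)) t ∈ hullValues f :=
  ⟨bebutovFlow EllTwo t g, mapsTo_bebutovFlow_hull f t g.2,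
    congrArg (g : C(ℝ, EllTwo)) (zero_add t)⟩

section Cocycle

variable {ν lam : ℝ} {F : ℝ → ℝ} {hF : LipschitzOnBounded F} {hF0 : F 0 = 0}
  {f : C(ℝ, EllTwo)} {φ : ℝ≥0 → EllTwo → hull f → EllTwo}

theorem exists_isGeneratedByLattice (hν : 0 ≤ ν) (hlam : 0 < lam) (hsign : ∀ s, s * F s ≤ 0)
    (hf : TranslationCompact f) :
    ∃ φ : ℝ≥0 → EllTwo → hull f → EllTwo, IsGeneratedByLattice ν lam F hF hF0 f φ := by
  obtain ⟨C, hC⟩ := (isCompact_hullValues hf).isBounded.exists_norm_le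
  have hgC : ∀ (g : hull f) t, ‖(g : C(ℝ, EllTwo)) t‖ ≤ C := fun g t =>
    hC _ (apply_mem_hullValues g t)
  choose sol hsol0 hsol using fun (v : EllTwo) (g : hull f) =>
    exists_isLatticeSolutionOn_Ici hν hlam hF hF0 hsign (hgC g) v
  refine ⟨fun t v g => sol v g t, fun v g => hsol0 v g, fun v g t ht => ?_, ?_⟩
  · have e : ∀ s ∈ Set.Ici (0 : ℝ), sol v g (s.toNNReal : ℝ) = sol v g s := fun s hs => by
      rw [Real.coe_toNNReal s hs]
    simp only [e t ht]
    exact (hsol v g t ht).congr e (e t ht)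
  · intro v g T u hu0 hu t ht
    have := hu.eqOn hν hlam hsign (hgC g) (T := t) (hsol v g)
      (fun s hs => ⟨hs.1, hs.2.trans_lt ht.2⟩) Set.Icc_subset_Ici_self
      (hu0.trans (hsol0 v g).symm) (Set.right_mem_Icc.2 ht.1)
    simpa only [Real.coe_toNNReal t ht.1] using this

theorem IsGeneratedByLattice.continuous_time (hφ : IsGeneratedByLattice ν lam F hF hF0 f φ)
    (v : EllTwo) (g : hull f) : Continuous fun t => φ t v g := by
  have h := (hφ.solution v g).continuousOn.comp_continuous NNReal.continuous_coe
    (fun t => t.2)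
  simpa only [Function.comp_def, Real.toNNReal_coe] using h

theorem IsGeneratedByLattice.add (hφ : IsGeneratedByLattice ν lam F hF hF0 f φ)
    (t τ : ℝ≥0) (v : EllTwo) (g : hull f) :
    φ (t + τ) v g = φ t (φ τ v g) (hullFlow f (τ : ℝ) g) := by
  -- The shifted solution solves the shifted equation; the horizon `t + 1` makes the half-open
  -- interval contain `t`.
  have h := hφ.unique (φ τ v g) (hullFlow f (τ : ℝ) g) (t + 1)
    (fun s => φ (s + τ).toNNReal v g) (by simp)
    (fun s hs => ((hφ.solution v g).shift τ.2 s hs.1).mono Set.Ico_subset_Ici_self)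
    t ⟨t.2, by linarith⟩
  rw [Real.toNNReal_coe] at h
  rw [← h, ← NNReal.coe_add, Real.toNNReal_coe]

/-- Continuity in time for fixed data, plus a comparison of data at equal times that is uniform on
`[0, t₀ + 1]`. The compact-open topology makes the distance of forcings on this interval continuous.
-/
theorem IsGeneratedByLattice.continuous (hφ : IsGeneratedByLattice ν lam F hF hF0 f φ)
    (hν : 0 ≤ ν) (hlam : 0 < lam) (hsign : ∀ s, s * F s ≤ 0) (hf : TranslationCompact f) :
    Continuous fun p : ℝ≥0 × EllTwo × hull f => φ p.1 p.2.1 p.2.2 := by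
  obtain ⟨C, hC⟩ := (isCompact_hullValues hf).isBounded.exists_norm_le
  rw [continuous_iff_continuousAt]
  rintro ⟨t₀, v₀, g₀⟩
  set T : ℝ := t₀ + 1 with hTdef
  set R : ℝ := Real.sqrt ((‖v₀‖ + 1) ^ 2 + 2 / lam ^ 2 * C ^ 2) + 1 with hRdef
  obtain ⟨K, hK0, hK⟩ := exists_dist_solution_le ν lam hF hF0 (show 0 < R by positivity)
  have hbound : ∀ v (g : hull f), ‖v‖ ≤ ‖v₀‖ + 1 → ∀ s ∈ Set.Icc 0 T,
      ‖φ s.toNNReal v g‖ ≤ R := by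
    intro v g hv s hs
    have h1 := (hφ.solution v g).norm_sq_le hν hlam hsign
      (fun t => hC _ (apply_mem_hullValues g t)) Set.Icc_subset_Ici_self hs
    rw [Real.toNNReal_zero, hφ.initial] at h1
    have h2 : ‖v‖ ^ 2 ≤ (‖v₀‖ + 1) ^ 2 := pow_le_pow_left₀ (norm_nonneg _) hv 2
    have := Real.le_sqrt_of_sq_le (h1.trans (add_le_add_left h2 _))
    linarith
  let D (g : hull f) : ℝ := dist ((g : C(ℝ, EllTwo)).restrict (Set.Icc 0 T))
    ((g₀ : C(ℝ, EllTwo)).restrict (Set.Icc 0 T))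
  have hD : Continuous D :=
    ((ContinuousMap.continuous_restrict _).comp continuous_subtype_val).dist continuous_const
  have hdist : ∀ᶠ p : ℝ≥0 × EllTwo × hull f in 𝓝 (t₀, v₀, g₀),
      dist (φ p.1 v₀ g₀) (φ p.1 p.2.1 p.2.2) ≤
        (dist p.2.1 v₀ + D p.2.2) * Real.exp (K * T) := by
    have e1 : ∀ᶠ p : ℝ≥0 × EllTwo × hull f in 𝓝 (t₀, v₀, g₀), p.1 < t₀ + 1 :=
      continuous_fst.continuousAt.eventually (gt_mem_nhds (by simp))
    have e2 : ∀ᶠ p : ℝ≥0 × EllTwo × hull f in 𝓝 (t₀, v₀, g₀), ‖p.2.1‖ < ‖v₀‖ + 1 :=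
      (continuous_fst.comp continuous_snd).norm.continuousAt.eventually
        (gt_mem_nhds (by simp))
    filter_upwards [e1, e2] with p hp1 hp2
    have hpT : (p.1 : ℝ) ∈ Set.Icc 0 T := ⟨p.1.2, by exact_mod_cast hp1.le⟩
    have h := hK p.2.2 g₀ _ _ _ _ T (D p.2.2) (hφ.solution p.2.1 p.2.2) (hφ.solution v₀ g₀)
      Set.Icc_subset_Ici_self Set.Icc_subset_Ici_self (hbound _ _ hp2.le)
      (hbound _ _ (by linarith)) dist_nonneg
      (fun s hs => ContinuousMap.dist_apply_le_dist (f := (p.2.2 : C(ℝ, EllTwo)).restrict _)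
        (g := (g₀ : C(ℝ, EllTwo)).restrict _) (⟨s, hs⟩ : Set.Icc 0 T)) p.1 hpT
    simp only [Real.toNNReal_coe, Real.toNNReal_zero, hφ.initial] at h
    rw [dist_comm]
    refine h.trans (mul_le_mul_of_nonneg_left ?_ (add_nonneg dist_nonneg dist_nonneg))
    gcongr
    exact hpT.2
  have hlim : Filter.Tendsto (fun p : ℝ≥0 × EllTwo × hull f =>
      (dist p.2.1 v₀ + D p.2.2) * Real.exp (K * T)) (𝓝 (t₀, v₀, g₀)) (𝓝 0) := by
    have hc : Continuous fun p : ℝ≥0 × EllTwo × hull f =>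
        (dist p.2.1 v₀ + D p.2.2) * Real.exp (K * T) := by fun_prop
    have := hc.tendsto (t₀, v₀, g₀)
    simpa [D] using this
  have hd0 := squeeze_zero' (Filter.Eventually.of_forall fun _ => dist_nonneg) hdist hlim
  exact (((hφ.continuous_time v₀ g₀).comp continuous_fst).tendsto (t₀, v₀, g₀)).congr_dist hd0

theorem IsGeneratedByLattice.isCocycle (hφ : IsGeneratedByLattice ν lam F hF hF0 f φ)
    (hν : 0 ≤ ν) (hlam : 0 < lam) (hsign : ∀ s, s * F s ≤ 0) (hf : TranslationCompact f) :
    IsCocycle (hullFlow f) φ :=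
  ⟨hφ.continuous hν hlam hsign hf, hφ.initial, hφ.add⟩

theorem IsGeneratedByLattice.weightedSq_le (hφ : IsGeneratedByLattice ν lam F hF hF0 f φ)
    (hν : 0 ≤ ν) (hlam : 0 < lam) (hsign : ∀ s, s * F s ≤ 0) {ρ : ℤ → ℝ}
    (hρ : EllTwo.IsLatticeWeight ν lam ρ) {a : ℝ}
    (ha : ∀ z ∈ hullValues f, EllTwo.weightedSq ρ z ≤ a) (t : ℝ≥0) (v : EllTwo) (g : hull f) :
    EllTwo.weightedSq ρ (φ t v g) ≤ Real.exp (-lam * t) * EllTwo.weightedSq ρ v +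
      (1 - Real.exp (-lam * t)) * (2 / lam ^ 2 * a) := by
  have h := (hφ.solution v g).weightedSq_le hν hlam hsign hρ
    (fun t => ha _ (apply_mem_hullValues g t)) Set.Icc_subset_Ici_self
    (Set.right_mem_Icc.2 t.coe_nonneg)
  simpa only [Real.toNNReal_coe, Real.toNNReal_zero, hφ.initial] using h

theorem IsGeneratedByLattice.exists_isCompactGlobalAttractor
    (hφ : IsGeneratedByLattice ν lam F hF hF0 f φ) (hν : 0 ≤ ν) (hlam : 0 < lam)
    (hsign : ∀ s, s * F s ≤ 0) (hf : TranslationCompact f) :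
    ∃ I : hull f → Set EllTwo, IsCompactGlobalAttractor (hullFlow f) φ I := by
  have : CompactSpace (hull f) := isCompact_iff_compactSpace.1 hf
  set c : ℝ := 1 + 4 * ν / lam with hcdef
  have hc : 1 ≤ c := by
    have : 0 ≤ 4 * ν / lam := by positivity
    linarith
  have hc' : 4 * ν ≤ lam * c := by
    rw [hcdef, mul_add, mul_div_cancel₀ _ hlam.ne']
    linarith
  have hw := EllTwo.isLatticeWeight_tailWeight hν hlam hc hc'
  obtain ⟨a, ha0, halim, ha⟩ := EllTwo.exists_tail_bound hc (isCompact_hullValues hf)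
  have hb0 : ∀ k, 0 ≤ 2 / lam ^ 2 * a k := fun k => mul_nonneg (by positivity) (ha0 k)
  have hblim : Filter.Tendsto (fun k => 2 / lam ^ 2 * a k) Filter.atTop (𝓝 0) := by
    simpa using halim.const_mul (2 / lam ^ 2)
  have hest := fun k => hφ.weightedSq_le hν hlam hsign (hw k) (ha k)
  have hexp : ∀ t : ℝ≥0, Real.exp (-lam * t) ≤ 1 := fun t =>
    Real.exp_le_one_iff.2 (by nlinarith [t.2])
  refine ⟨_, isCompactGlobalAttractor_pullbackLimit
    (K := {u | ∀ k, EllTwo.weightedSq (EllTwo.tailWeight c k) u ≤ 2 / lam ^ 2 * a k})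
    (hφ.isCocycle hν hlam hsign hf)
    (EllTwo.isCompact_setOf_weightedSq_tailWeight_le hc hblim) ⟨0, fun k => ?_⟩
    (fun t u hu y k => ?_) fun M hM U hUt hUM => ?_⟩
  · simpa [EllTwo.weightedSq] using hb0 k
  -- The estimate is a convex combination of the initial tail and the bound defining `K`.
  · have h1 := hest k t u y
    have h2 := mul_le_mul_of_nonneg_left (hu k) (Real.exp_pos (-lam * t)).le
    linarith
  · obtain ⟨m, hm0, hmlim, hm⟩ := EllTwo.exists_tail_bound hc hM
    have hφM : ∀ᶠ p in (U : Filter (ℝ≥0 × EllTwo × hull f)), ∀ k,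
        EllTwo.weightedSq (EllTwo.tailWeight c k) (φ p.1 p.2.1 p.2.2) ≤
          Real.exp (-lam * p.1) * m k + 2 / lam ^ 2 * a k := by
      filter_upwards [hUM] with p hp k
      have h1 := hest k p.1 p.2.1 p.2.2
      have h2 := mul_le_mul_of_nonneg_left (hm k _ hp) (Real.exp_pos (-lam * p.1)).le
      have h3 := mul_nonneg (Real.exp_pos (-lam * p.1)).le (hb0 k)
      linarith
    -- These bounds hold at all times, so the trajectories from `M` stay in a compact set, larger
    -- than `K`, and a limit exists.
    have hlim : Filter.Tendsto (fun k => m k + 2 / lam ^ 2 * a k) Filter.atTop (𝓝 0) := by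
      simpa using hmlim.add hblim
    obtain ⟨w, -, hUw⟩ :=
      (EllTwo.isCompact_setOf_weightedSq_tailWeight_le hc hlim).ultrafilter_le_nhds
      (U.map fun p : ℝ≥0 × EllTwo × hull f => φ p.1 p.2.1 p.2.2) (by
        refine Filter.le_principal_iff.2 (Filter.mem_map.2 ?_)
        filter_upwards [hφM] with p hp k
        exact (hp k).trans (add_le_add_left (mul_le_of_le_one_left (hm0 k) (hexp p.1)) _))
    have hUw' : Filter.Tendsto (fun p : ℝ≥0 × EllTwo × hull f => φ p.1 p.2.1 p.2.2) U (𝓝 w) := hUw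
    refine ⟨w, fun k => ?_, hUw'⟩
    -- As time grows the factor `exp (-lam t)` removes `m k`, which puts the limit in `K` itself.
    have h1 := ((EllTwo.continuous_weightedSq (EllTwo.tailWeight_mem_Icc hc k)).tendsto w).comp hUw'
    have h2 : Filter.Tendsto (fun p : ℝ≥0 × EllTwo × hull f => Real.exp (-lam * p.1)) U (𝓝 0) := by
      refine Real.tendsto_exp_atBot.comp (Filter.Tendsto.const_mul_atTop_of_neg (by linarith) ?_)
      exact (NNReal.tendsto_coe_atTop.2 hUt)
    have h3 := (h2.mul_const (m k)).add_const (2 / lam ^ 2 * a k)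
    rw [zero_mul, zero_add] at h3
    exact le_of_tendsto_of_tendsto h1 h3 (hφM.mono fun p hp => hp k)

end Cocycle

theorem theorem5p2 (ν lam α : ℝ) (hν : 0 ≤ ν) (hlam : 0 < lam) (hα : 0 ≤ α)
    (f : C(ℝ, EllTwo)) (hC1 : TranslationCompact f)
    (F : ℝ → ℝ) (hC2 : LipschitzOnBounded F) (hF0 : F 0 = 0)
    (hC3 : ∀ s : ℝ, s * F s ≤ -α * s ^ 2) :
    ∃ φ : ℝ≥0 → EllTwo → hull f → EllTwo,
      IsGeneratedByLattice ν lam F hC2 hF0 f φ ∧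
      IsCocycle (hullFlow f) φ ∧
      ∃ I : hull f → Set EllTwo, IsCompactGlobalAttractor (hullFlow f) φ I := by
  have hsign : ∀ s, s * F s ≤ 0 := fun s => (hC3 s).trans (by nlinarith [sq_nonneg s])
  obtain ⟨φ, hφ⟩ := exists_isGeneratedByLattice (hF := hC2) (hF0 := hF0) hν hlam hsign hC1
  exact ⟨φ, hφ, hφ.isCocycle hν hlam hsign hC1,
    hφ.exists_isCompactGlobalAttractor hν hlam hsign hC1⟩
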